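/- Let $N \ge 0$ be an integer, let $\mathscr{H}$ be a complex separable Hilbert space, let $\mu$ be a Borel probability measure on $\mathbb{R}^N$, and let $x \mapsto \rho_x$ be a Borel measurable map from $\mathbb{R}^N$ to the density operators on $\mathscr{H}$ (positive trace-class operators of trace one). For a Borel set $E \subseteq \mathbb{R}^N$ put $\rho_E = \int_E \rho_x\,\mu(dx)$ and $\rho = \int_{\mathbb{R}^N} \rho_x\,\mu(dx)$ (Bochner integrals), and let $\Lambda_E$ be the unique bounded operator on $\mathscr{H}$ with $\|\Lambda_E\| \le 1$, $\ker \rho \subseteq \ker \Lambda_E$ and $\Lambda_E \rho^{1/2} = \rho_E^{1/2}$. The generalized pretty good measurement of the ensemble is the positive operator-valued measure $$m^{\mathrm{PG}}(E) = \Lambda_E^\dagger \Lambda_E + \mu(E)\,\Pi_{\ker \rho},$$ where $\Pi_{\ker\rho}$ is the orthogonal projection onto $\ker \rho$. Its expected mean square error is $$\mathrm{MSE} = \int_{\mathbb{R}^N} \int_{\mathbb{R}^N} \|x - \hat x\|^2 \, \operatorname{Tr}[\rho_x\, m^{\mathrm{PG}}(d\hat x)]\, \mu(dx) \in [0,\infty],$$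 with $\|\cdot\|$ the Euclidean norm. If $\mu$ has finite second moment $\int_{\mathbb{R}^N} \|x\|^2\,\mu(dx) < \infty$, then $\mathrm{MSE} < \infty$, and more precisely $$\mathrm{MSE} \le 4 \int_{\mathbb{R}^N} \|x\|^2\,\mu(dx).$$ -/

import Mathlib

set_option linter.unusedSectionVars false

open MeasureTheory Filter Topology
open scoped ENNReal InnerProductSpace

noncomputable section

namespace QuantumEstimation

/-! ### Trace and density operators -/

section Trace

variable {H : Type*} [NormedAddCommGroup H] [InnerProductSpace ℂ H] [CompleteSpace H]

variable (H) in
/-- A fixed orthonormal (Hilbert) basis of `H`, used to write traces. -/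
def stdBasis : HilbertBasis (exists_hilbertBasis ℂ H).choose ℂ H :=
  (exists_hilbertBasis ℂ H).choose_spec.choose

/-- The trace `Tr T = ∑ i, ⟪e i, T (e i)⟫`. For trace-class `T` the series converges absolutely and
its value does not depend on the orthonormal basis. It is used below only for products `T A` of a
density operator `T` and a bounded operator `A`, which are trace class. -/
def opTrace (T : H →L[ℂ] H) : ℂ := ∑' i, ⟪stdBasis H i, T (stdBasis H i)⟫_ℂ

/-- Density operators: positive (self-adjoint) operators that are trace class with trace one. For a
positive operator, being trace class means that the series of nonnegative diagonal entries
converges, and convergence and value are the same for every orthonormal basis. -/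
structure IsDensityOperator (T : H →L[ℂ] H) : Prop where
  isPositive : T.IsPositive
  trace_one : HasSum (fun i => ⟪stdBasis H i, T (stdBasis H i)⟫_ℂ) 1

lemma sqrt_sqrt_apply {T : H →L[ℂ] H} (hT : T.IsPositive) (v : H) :
    CFC.sqrt T (CFC.sqrt T v) = T v := by
  have h0 : 0 ≤ T := (ContinuousLinearMap.nonneg_iff_isPositive T).2 hT
  conv_rhs => rw [← CFC.sqrt_mul_sqrt_self T h0]
  rfl

lemma inner_sqrt_apply (T : H →L[ℂ] H) (u v : H) :
    ⟪CFC.sqrt T u, v⟫_ℂ = ⟪u, CFC.sqrt T v⟫_ℂ := by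
  have hs : IsSelfAdjoint (CFC.sqrt T) := (CFC.sqrt_nonneg T).isSelfAdjoint
  rw [← ContinuousLinearMap.adjoint_inner_left, hs.adjoint_eq]

lemma norm_sqrt_sq {T : H →L[ℂ] H} (hT : T.IsPositive) (v : H) :
    ‖CFC.sqrt T v‖ ^ 2 = (⟪v, T v⟫_ℂ).re := by
  rw [← sqrt_sqrt_apply hT, ← inner_sqrt_apply, inner_self_eq_norm_sq_to_K]
  norm_cast

lemma hasSum_norm_inner_sq {K ι : Type*} [NormedAddCommGroup K] [InnerProductSpace ℂ K]
    (b : HilbertBasis ι ℂ K) (v : K) :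
    HasSum (fun i => ‖⟪b i, v⟫_ℂ‖ ^ 2) (‖v‖ ^ 2) := by
  have h := b.hasSum_inner_mul_inner v v
  rw [inner_self_eq_norm_sq_to_K] at h
  have h2 := Complex.hasSum_re h
  have e : ((‖v‖ : ℂ) ^ 2).re = ‖v‖ ^ 2 := by norm_cast
  have e2 : ∀ i, (⟪v, b i⟫_ℂ * ⟪b i, v⟫_ℂ).re = ‖⟪b i, v⟫_ℂ‖ ^ 2 := fun i => by
    rw [← inner_conj_symm, ← Complex.normSq_eq_conj_mul_self, Complex.normSq_eq_norm_sq]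
    norm_cast
  simp_rw [e2] at h2
  exact e ▸ h2

lemma IsDensityOperator.hasSum_norm_sqrt {T : H →L[ℂ] H} (hT : IsDensityOperator T) :
    HasSum (fun i => ‖CFC.sqrt T (stdBasis H i)‖ ^ 2) 1 := by
  simp_rw [norm_sqrt_sq hT.isPositive]
  simpa using Complex.hasSum_re hT.trace_one

lemma IsDensityOperator.norm_sqrt_apply_le {T : H →L[ℂ] H} (hT : IsDensityOperator T) (v : H) :
    ‖CFC.sqrt T v‖ ≤ ‖v‖ := by
  have h1 := hasSum_norm_inner_sq (stdBasis H) (CFC.sqrt T v)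
  have h2 := hT.hasSum_norm_sqrt.mul_right (‖v‖ ^ 2)
  have h3 : ‖CFC.sqrt T v‖ ^ 2 ≤ 1 * ‖v‖ ^ 2 := by
    refine hasSum_le (fun i => ?_) h1 h2
    rw [← inner_sqrt_apply, ← mul_pow]
    gcongr
    exact norm_inner_le_norm _ _
  rw [one_mul] at h3
  exact (sq_le_sq₀ (norm_nonneg _) (norm_nonneg _)).1 h3

lemma IsDensityOperator.norm_le_one {T : H →L[ℂ] H} (hT : IsDensityOperator T) : ‖T‖ ≤ 1 := by
  refine T.opNorm_le_bound zero_le_one fun v => ?_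
  rw [← sqrt_sqrt_apply hT.isPositive, one_mul]
  exact (hT.norm_sqrt_apply_le _).trans (hT.norm_sqrt_apply_le _)

/-- Cyclicity: `Tr[T A] = Tr[T^(1/2) A T^(1/2)]` for a density operator `T` and bounded `A`. -/
lemma IsDensityOperator.exists_hasSum {T : H →L[ℂ] H} (hT : IsDensityOperator T)
    (A : H →L[ℂ] H) : ∃ t : ℂ,
      HasSum (fun i => ⟪stdBasis H i, (T ∘L A) (stdBasis H i)⟫_ℂ) t ∧
      HasSum (fun i => ⟪CFC.sqrt T (stdBasis H i), A (CFC.sqrt T (stdBasis H i))⟫_ℂ) t := by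
  set b := stdBasis H
  set S := CFC.sqrt T
  let f : _ × _ → ℂ := fun p => ⟪S (b p.1), b p.2⟫_ℂ * ⟪b p.2, S (A (b p.1))⟫_ℂ
  have hs : Summable (fun i => ‖S (b i)‖ ^ 2) := hT.hasSum_norm_sqrt.summable
  have r1 : ∀ i, HasSum (fun j => ‖⟪S (b i), b j⟫_ℂ‖ ^ 2) (‖S (b i)‖ ^ 2) := fun i => by
    simpa only [norm_inner_symm] using hasSum_norm_inner_sq b (S (b i))
  have g1 : Summable (fun p : _ × _ => ‖⟪S (b p.1), b p.2⟫_ℂ‖ ^ 2) := by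
    refine (summable_prod_of_nonneg (fun p => sq_nonneg _)).2 ⟨fun i => (r1 i).summable, ?_⟩
    simpa only [(r1 _).tsum_eq] using hs
  have r2 : ∀ j, HasSum (fun i => ‖⟪b j, S (A (b i))⟫_ℂ‖ ^ 2) (‖A.adjoint (S (b j))‖ ^ 2) :=
    fun j => by
      have e : ∀ i, ‖⟪b j, S (A (b i))⟫_ℂ‖ = ‖⟪b i, A.adjoint (S (b j))⟫_ℂ‖ := fun i => by
        rw [← inner_sqrt_apply, ← ContinuousLinearMap.adjoint_inner_left, norm_inner_symm]
      simpa only [e] using hasSum_norm_inner_sq b (A.adjoint (S (b j)))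
  have g2 : Summable (fun p : _ × _ => ‖⟪b p.2, S (A (b p.1))⟫_ℂ‖ ^ 2) := by
    rw [← (Equiv.prodComm _ _).summable_iff]
    refine (summable_prod_of_nonneg (fun p => sq_nonneg _)).2 ⟨fun j => (r2 j).summable, ?_⟩
    simp only [Equiv.prodComm_apply, Prod.swap_prod_mk, (r2 _).tsum_eq]
    refine Summable.of_nonneg_of_le (fun _ => sq_nonneg _) (fun j => ?_)
      (hs.mul_left (‖A.adjoint‖ ^ 2))
    rw [← mul_pow]
    gcongr
    exact ContinuousLinearMap.le_opNorm _ _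
  have hf : Summable f := by
    refine Summable.of_norm_bounded ((g1.add g2).mul_left (1 / 2)) fun p => ?_
    rw [norm_mul]
    nlinarith [sq_nonneg (‖⟪S (b p.1), b p.2⟫_ℂ‖ - ‖⟪b p.2, S (A (b p.1))⟫_ℂ‖)]
  refine ⟨∑' p, f p, hf.hasSum.prod_fiberwise fun i => ?_,
    ((Equiv.prodComm _ _).hasSum_iff.2 hf.hasSum).prod_fiberwise fun j => ?_⟩
  · have h := b.hasSum_inner_mul_inner (S (b i)) (S (A (b i)))
    have e : ⟪S (b i), S (A (b i))⟫_ℂ = ⟪b i, (T ∘L A) (b i)⟫_ℂ := by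
      rw [inner_sqrt_apply, sqrt_sqrt_apply hT.isPositive]; rfl
    exact e ▸ h
  · have h := b.hasSum_inner_mul_inner (A.adjoint (S (b j))) (S (b j))
    rw [ContinuousLinearMap.adjoint_inner_left] at h
    refine (congrArg (fun g => HasSum g _) (funext fun i => ?_)).mpr h
    change ⟪S (b i), b j⟫_ℂ * ⟪b j, S (A (b i))⟫_ℂ = _
    rw [ContinuousLinearMap.adjoint_inner_left, mul_comm,
      show ⟪S (b i), b j⟫_ℂ = ⟪b i, S (b j)⟫_ℂ from inner_sqrt_apply T _ _,
      show ⟪S (b j), A (b i)⟫_ℂ = ⟪b j, S (A (b i))⟫_ℂ from inner_sqrt_apply T _ _]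

/-- A Hilbert-Schmidt operator is the norm-convergent sum of its rank-one pieces. -/
lemma hasSum_rankOne {K ι : Type*} [NormedAddCommGroup K] [InnerProductSpace ℂ K]
    [CompleteSpace K] (b : HilbertBasis ι ℂ K) (T : K →L[ℂ] K)
    (hT : Summable fun i => ‖T (b i)‖ ^ 2) :
    HasSum (fun i => InnerProductSpace.rankOne ℂ (T (b i)) (b i)) T := by
  have hsum : Summable (fun i => InnerProductSpace.rankOne ℂ (T (b i)) (b i)) := by
    rw [summable_iff_vanishing_norm]
    intro ε hε
    obtain ⟨s, hs⟩ := summable_iff_vanishing_norm.1 hT ((ε / 2) ^ 2) (by positivity)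
    refine ⟨s, fun t ht => ?_⟩
    have h1 := hs t ht
    rw [Real.norm_of_nonneg (Finset.sum_nonneg fun _ _ => sq_nonneg _)] at h1
    refine lt_of_le_of_lt (ContinuousLinearMap.opNorm_le_bound _ (half_pos hε).le fun v => ?_)
      (half_lt_self hε)
    have h2 : ∑ i ∈ t, ‖⟪b i, v⟫_ℂ‖ ^ 2 ≤ ‖v‖ ^ 2 :=
      sum_le_hasSum t (fun _ _ => sq_nonneg _) (hasSum_norm_inner_sq b v)
    have h3 : ‖∑ i ∈ t, ⟪b i, v⟫_ℂ • T (b i)‖ ≤ ∑ i ∈ t, ‖⟪b i, v⟫_ℂ‖ * ‖T (b i)‖ :=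
      (norm_sum_le _ _).trans_eq (by simp_rw [norm_smul])
    have h4 := Finset.sum_mul_sq_le_sq_mul_sq t (fun i => ‖⟪b i, v⟫_ℂ‖) (fun i => ‖T (b i)‖)
    have h5 : (∑ i ∈ t, ‖⟪b i, v⟫_ℂ‖ * ‖T (b i)‖) ^ 2 ≤ (ε / 2 * ‖v‖) ^ 2 := by
      rw [mul_pow, mul_comm ((ε / 2) ^ 2)]
      exact h4.trans (mul_le_mul h2 h1.le (Finset.sum_nonneg fun _ _ => sq_nonneg _)
        (sq_nonneg _))
    have h6 := (sq_le_sq₀ (Finset.sum_nonneg fun _ _ => by positivity) (by positivity)).1 h5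
    simpa using h3.trans h6
  convert hsum.hasSum using 1
  ext v
  have h1 := (ContinuousLinearMap.apply ℂ K v).hasSum hsum.hasSum
  have h2 := T.hasSum (b.hasSum_repr v)
  refine h2.unique ?_
  have e : ∀ i, T (b.repr v i • b i) =
      ContinuousLinearMap.apply ℂ K v (InnerProductSpace.rankOne ℂ (T (b i)) (b i)) := fun i => by
    simp [b.repr_apply_apply]
  simp_rw [e]
  exact h1

end Trace

section POVM

variable (X : Type*) [MeasurableSpace X] (H : Type*) [NormedAddCommGroup H]
  [InnerProductSpace ℂ H] [CompleteSpace H]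

/-- Probability operator-valued measures on `X`: maps from the measurable sets to the positive
bounded operators, countably additive in the strong operator topology, with total mass the
identity. The values at non-measurable sets play no role. -/
structure POVM where
  toFun : Set X → H →L[ℂ] H
  isPositive : ∀ E, MeasurableSet E → (toFun E).IsPositive
  univ : toFun Set.univ = 1
  hasSum_iUnion : ∀ E : ℕ → Set X, (∀ n, MeasurableSet (E n)) →
    Pairwise (Function.onFun Disjoint E) → ∀ ψ : H,
      HasSum (fun n => toFun (E n) ψ) (toFun (⋃ n, E n) ψ)

variable {X H}

lemma POVM.empty (m : POVM X H) : m.toFun ∅ = 0 := by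
  ext ψ
  have h := m.hasSum_iUnion (fun _ => ∅) (fun _ => MeasurableSet.empty)
    (fun _ _ _ => disjoint_bot_left) ψ
  exact (summable_const_iff _).1 h.summable

lemma ofReal_opTrace {T : H →L[ℂ] H} (hT : IsDensityOperator T) {A : H →L[ℂ] H}
    (hA : A.IsPositive) : ENNReal.ofReal (opTrace (T ∘L A)).re =
      ∑' i, ENNReal.ofReal
        (⟪CFC.sqrt T (stdBasis H i), A (CFC.sqrt T (stdBasis H i))⟫_ℂ).re := by
  obtain ⟨t, h1, h2⟩ := hT.exists_hasSum A
  have h3 := Complex.hasSum_re h2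
  rw [opTrace, h1.tsum_eq, ← h3.tsum_eq]
  exact ENNReal.ofReal_tsum_of_nonneg (fun i => hA.re_inner_nonneg_right _) h3.summable

/-- The law `E ↦ Tr[T m(E)]` of the outcome of the measurement `m` in the state `T`. -/
def outcomeMeasure (T : H →L[ℂ] H) (hT : IsDensityOperator T) (m : POVM X H) : Measure X :=
  Measure.ofMeasurable (fun E _ => ENNReal.ofReal (opTrace (T ∘L m.toFun E)).re)
    (by simp [m.empty, opTrace])
    (by
      intro E hE hd
      simp_rw [ofReal_opTrace hT (m.isPositive _ (MeasurableSet.iUnion hE)),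
        ofReal_opTrace hT (m.isPositive _ (hE _))]
      rw [ENNReal.tsum_comm]
      refine tsum_congr fun i => ?_
      set v := CFC.sqrt T (stdBasis H i)
      have h := Complex.hasSum_re ((innerSL ℂ v).hasSum (m.hasSum_iUnion E hE hd v))
      simp only [innerSL_apply_apply] at h
      rw [← h.tsum_eq]
      exact ENNReal.ofReal_tsum_of_nonneg
        (fun n => (m.isPositive _ (hE n)).re_inner_nonneg_right _) h.summable)

end POVM

section Ensemble

variable (X : Type*) [MeasurableSpace X] (H : Type*) [NormedAddCommGroup H]
  [InnerProductSpace ℂ H] [CompleteSpace H]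

/-- A quantum ensemble `((μ(dx), ρ_x))_{x ∈ X}`: a probability measure `μ` (`prior`) on `X` and a
measurable family of density operators `ρ_x` (`state x`). Measurability refers to the Borel
σ-algebra of the bounded operators; on the set of density operators the operator norm and the
trace norm induce the same topology, hence the same Borel sets. -/
structure QuantumEnsemble where
  prior : Measure X
  isProbabilityMeasure : IsProbabilityMeasure prior
  state : X → H →L[ℂ] H
  isDensityOperator : ∀ x, IsDensityOperator (state x)
  measurable : Measurable state

variable {X H} [TopologicalSpace.SeparableSpace H]

attribute [instance] QuantumEnsemble.isProbabilityMeasure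

lemma countable_of_hilbertBasis {K ι : Type*} [NormedAddCommGroup K] [InnerProductSpace ℂ K]
    [TopologicalSpace.SeparableSpace K] (b : HilbertBasis ι ℂ K) : Countable ι := by
  rw [← Set.countable_univ_iff]
  refine Set.PairwiseDisjoint.countable_of_isOpen (s := fun i => Metric.ball (b i) (1 / 2)) ?_
    (fun _ _ => Metric.isOpen_ball) (fun i _ => ⟨b i, by simp⟩)
  intro i _ j _ hij
  refine Metric.ball_disjoint_ball ?_
  rw [dist_eq_norm]
  have h : ‖b i - b j‖ ^ 2 = 2 := by
    rw [@norm_sub_sq ℂ, b.orthonormal.1, b.orthonormal.1, b.orthonormal.2 hij]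
    norm_num
  nlinarith [norm_nonneg (b i - b j)]

namespace QuantumEnsemble

variable (𝓔 : QuantumEnsemble X H)

lemma stronglyMeasurable_state : StronglyMeasurable 𝓔.state := by
  set b := stdBasis H
  have hc := countable_of_hilbertBasis b
  refine stronglyMeasurable_of_tendsto atTop
    (f := fun (s : Finset _) x => ∑ i ∈ s, InnerProductSpace.rankOne ℂ (𝓔.state x (b i)) (b i))
    (fun s => ?_) (tendsto_pi_nhds.2 fun x => hasSum_rankOne b (𝓔.state x) ?_)
  · refine Finset.stronglyMeasurable_fun_sum s fun i _ => ?_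
    borelize H
    have h1 : StronglyMeasurable fun x => 𝓔.state x (b i) :=
      (𝓔.measurable.apply_continuousLinearMap (b i)).stronglyMeasurable
    have h2 : Continuous fun v : H => InnerProductSpace.rankOne ℂ v (b i) :=
      ((ContinuousLinearMap.apply' _ _ (b i)).comp
        (InnerProductSpace.rankOne ℂ (E := H) (F := H))).continuous
    exact h2.comp_stronglyMeasurable h1
  · have hd := 𝓔.isDensityOperator x
    refine Summable.of_nonneg_of_le (fun _ => sq_nonneg _) (fun i => ?_)
      hd.hasSum_norm_sqrt.summable
    rw [← sqrt_sqrt_apply hd.isPositive]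
    gcongr
    exact hd.norm_sqrt_apply_le _

lemma integrable_state : Integrable 𝓔.state 𝓔.prior :=
  Integrable.of_bound 𝓔.stronglyMeasurable_state.aestronglyMeasurable 1
    (Eventually.of_forall fun x => (𝓔.isDensityOperator x).norm_le_one)

/-- `ρ_E = ∫_E ρ_x μ(dx)`, a Bochner integral. (The integral in the trace norm and the integral in
the operator norm are the same operator.) -/
def partialState (E : Set X) : H →L[ℂ] H := ∫ x in E, 𝓔.state x ∂𝓔.prior

/-- The average state `ρ = ∫ ρ_x μ(dx)`. -/
def averageState : H →L[ℂ] H := ∫ x, 𝓔.state x ∂𝓔.prior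

lemma inner_partialState (E : Set X) (v : H) :
    ⟪v, 𝓔.partialState E v⟫_ℂ = ((∫ x in E, (⟪v, 𝓔.state x v⟫_ℂ).re ∂𝓔.prior : ℝ) : ℂ) := by
  have hi := 𝓔.integrable_state.integrableOn (s := E)
  rw [partialState, ContinuousLinearMap.integral_apply hi,
    ← integral_inner (hi.apply_continuousLinearMap v)]
  refine Eq.trans (integral_congr_ae (Eventually.of_forall fun x => ?_)) integral_ofReal
  have h := (𝓔.isDensityOperator x).isPositive.inner_nonneg_right v
  exact (Complex.eq_re_of_ofReal_le h)

lemma integrable_quadForm (v : H) :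
    Integrable (fun x => (⟪v, 𝓔.state x v⟫_ℂ).re) 𝓔.prior :=
  ((𝓔.integrable_state.apply_continuousLinearMap v).const_inner (𝕜 := ℂ) v).re

lemma partialState_isPositive (E : Set X) : (𝓔.partialState E).IsPositive := by
  rw [ContinuousLinearMap.isPositive_iff_complex]
  intro v
  rw [← inner_conj_symm, inner_partialState]
  simp only [Complex.conj_ofReal, RCLike.re_to_complex, Complex.ofReal_re, true_and]
  exact integral_nonneg fun x => (𝓔.isDensityOperator x).isPositive.re_inner_nonneg_right v

lemma averageState_eq : 𝓔.averageState = 𝓔.partialState Set.univ := by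
  simp [averageState, partialState]

lemma averageState_isPositive : 𝓔.averageState.IsPositive := by
  rw [averageState_eq]; exact 𝓔.partialState_isPositive _

lemma norm_sqrt_partialState_le (E : Set X) (v : H) :
    ‖CFC.sqrt (𝓔.partialState E) v‖ ≤ ‖CFC.sqrt 𝓔.averageState v‖ := by
  refine (sq_le_sq₀ (norm_nonneg _) (norm_nonneg _)).1 ?_
  rw [averageState_eq, norm_sqrt_sq (𝓔.partialState_isPositive _),
    norm_sqrt_sq (𝓔.partialState_isPositive _), inner_partialState, inner_partialState,
    Complex.ofReal_re, Complex.ofReal_re, setIntegral_univ]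
  exact setIntegral_le_integral (𝓔.integrable_quadForm v) (Eventually.of_forall fun x =>
    (𝓔.isDensityOperator x).isPositive.re_inner_nonneg_right v)

lemma ker_sqrt_averageState : (CFC.sqrt 𝓔.averageState).ker = 𝓔.averageState.ker := by
  ext v
  simp only [LinearMap.mem_ker, ContinuousLinearMap.coe_coe]
  constructor
  · intro h
    rw [← sqrt_sqrt_apply 𝓔.averageState_isPositive, h, map_zero]
  · intro h
    have h1 := norm_sqrt_sq 𝓔.averageState_isPositive v
    rw [h, inner_zero_right] at h1
    simpa using h1

lemma orthogonal_range_sqrt : (CFC.sqrt 𝓔.averageState).rangeᗮ = 𝓔.averageState.ker := by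
  rw [ContinuousLinearMap.orthogonal_range,
    (CFC.sqrt_nonneg 𝓔.averageState).isSelfAdjoint.adjoint_eq, ker_sqrt_averageState]

/-- Vectors `ρ^(1/2) u + k` with `ρ k = 0` are dense. -/
lemma dense_range_add_ker :
    Dense {v : H | ∃ u k, 𝓔.averageState k = 0 ∧ v = CFC.sqrt 𝓔.averageState u + k} := by
  have h : Dense (((CFC.sqrt 𝓔.averageState).range ⊔ 𝓔.averageState.ker : Submodule ℂ H) :
      Set H) := by
    rw [Submodule.dense_iff_topologicalClosure_eq_top, Submodule.topologicalClosure_eq_top_iff,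
      ← Submodule.inf_orthogonal, orthogonal_range_sqrt, Submodule.inf_orthogonal_eq_bot]
  refine h.mono ?_
  intro v hv
  obtain ⟨y, ⟨u, rfl⟩, k, hk, rfl⟩ := Submodule.mem_sup.1 hv
  exact ⟨u, k, hk, rfl⟩

/-- The conditions `‖Λ_E‖ ≤ 1`, `ker ρ ⊆ ker Λ_E` and `Λ_E ρ^(1/2) = ρ_E^(1/2)`. -/
structure IsFactor (E : Set X) (L : H →L[ℂ] H) : Prop where
  norm_le_one : ‖L‖ ≤ 1
  ker_le : 𝓔.averageState.ker ≤ L.ker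
  comp_sqrt : L ∘L CFC.sqrt 𝓔.averageState = CFC.sqrt (𝓔.partialState E)

lemma existsUnique_factor (E : Set X) : ∃! L : H →L[ℂ] H, 𝓔.IsFactor E L := by
  set S := CFC.sqrt 𝓔.averageState with hS
  set A := CFC.sqrt (𝓔.partialState E)
  let K : Submodule ℂ H := S.range.topologicalClosure
  let e : H →ₗ[ℂ] K := S.toLinearMap.codRestrict K fun v =>
    Submodule.le_topologicalClosure _ ⟨v, rfl⟩
  have he : ∀ v, ((e v : K) : H) = S v := fun v => rfl
  have hd : DenseRange e := by
    intro y
    rw [closure_subtype]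
    have h1 : Subtype.val '' Set.range e = (S.range : Set H) := by
      ext z; constructor
      · rintro ⟨_, ⟨u, rfl⟩, rfl⟩; exact ⟨u, rfl⟩
      · rintro ⟨u, rfl⟩; exact ⟨e u, ⟨u, rfl⟩, rfl⟩
    rw [h1]
    exact y.2
  have hn : ∀ v, ‖A.toLinearMap v‖ ≤ 1 * ‖e v‖ := fun v => by
    rw [one_mul]
    exact 𝓔.norm_sqrt_partialState_le E v
  let G : K →L[ℂ] H := A.toLinearMap.extendOfNorm e
  have hG : ∀ v, G (e v) = A v := fun v => LinearMap.extendOfNorm_eq hd ⟨1, hn⟩ v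
  have hG1 : ∀ y, ‖G y‖ ≤ 1 * ‖y‖ := fun y => LinearMap.norm_extendOfNorm_apply_le hd 1 hn y
  refine ⟨G ∘L K.orthogonalProjectionOnto, ⟨?_, ?_, ?_⟩, ?_⟩
  · refine ContinuousLinearMap.opNorm_le_bound _ zero_le_one fun v => ?_
    refine (hG1 _).trans ?_
    gcongr
    exact K.norm_orthogonalProjectionOnto_apply_le v
  · intro v hv
    have h1 : v ∈ Kᗮ := by
      rw [Submodule.orthogonal_closure, orthogonal_range_sqrt]
      exact hv
    have h2 : K.orthogonalProjectionOnto v = 0 :=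
      Submodule.orthogonalProjectionOnto_apply_of_mem_orthogonal h1
    simp [h2]
  · ext v
    have h2 : K.orthogonalProjectionOnto (S v) = e v := 
      Submodule.orthogonalProjectionOnto_mem_subspace_eq_self (e v)
    change G (K.orthogonalProjectionOnto (S v)) = A v
    rw [h2, hG]
  · intro L hL
    ext v
    have h1 : G (K.orthogonalProjectionOnto v) = L (K.starProjection v) := by
      have h2 : (fun y : K => G y) = fun y : K => L y := by
        refine hd.equalizer G.continuous (L.continuous.comp continuous_subtype_val) ?_
        funext u
        change G (e u) = L (S u)
        rw [hG]
        exact (DFunLike.congr_fun hL.comp_sqrt u).symm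
      exact congrFun h2 _
    have h3 : L (v - K.starProjection v) = 0 := by
      refine hL.ker_le ?_
      rw [← orthogonal_range_sqrt, ← Submodule.orthogonal_closure]
      exact K.sub_starProjection_mem_orthogonal v
    rw [map_sub, sub_eq_zero] at h3
    exact h3.trans h1.symm

/-- The unique operator `Λ_E` given by `existsUnique_factor`. -/
def factor (E : Set X) : H →L[ℂ] H := (𝓔.existsUnique_factor E).choose

lemma factor_spec (E : Set X) : 𝓔.IsFactor E (𝓔.factor E) :=
  (𝓔.existsUnique_factor E).choose_spec.1

/-- `m(E) = Λ_E† Λ_E + μ(E) Π`, where `Π` is the orthogonal projection onto `ker ρ`. -/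
def pgm (E : Set X) : H →L[ℂ] H :=
  (𝓔.factor E).adjoint ∘L 𝓔.factor E +
    (𝓔.prior.real E : ℂ) • 𝓔.averageState.ker.starProjection

lemma re_inner_pgm (E : Set X) (v : H) : (⟪v, 𝓔.pgm E v⟫_ℂ).re =
    ‖𝓔.factor E v‖ ^ 2 + 𝓔.prior.real E * ‖𝓔.averageState.ker.starProjection v‖ ^ 2 := by
  have h1 : ⟪v, 𝓔.averageState.ker.starProjection v⟫_ℂ =
      ((‖𝓔.averageState.ker.starProjection v‖ ^ 2 : ℝ) : ℂ) := by
    have h2 := Submodule.starProjection_inner_eq_zero (K := 𝓔.averageState.ker) v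
      (𝓔.averageState.ker.starProjection v) (Submodule.starProjection_apply_mem _ v)
    rw [inner_sub_left, sub_eq_zero] at h2
    rw [h2, inner_self_eq_norm_sq_to_K]
    norm_cast
  simp only [pgm, add_apply, ContinuousLinearMap.comp_apply,
    smul_apply, inner_add_right, inner_smul_right, h1,
    ContinuousLinearMap.adjoint_inner_right, inner_self_eq_norm_sq_to_K]
  norm_cast

lemma pgm_isPositive (E : Set X) : (𝓔.pgm E).IsPositive := by
  refine (ContinuousLinearMap.isPositive_adjoint_comp_self _).add
    (ContinuousLinearMap.IsPositive.smul_of_nonneg ?_ ?_)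
  · exact ContinuousLinearMap.IsPositive.of_isStarProjection isStarProjection_starProjection
  · exact_mod_cast measureReal_nonneg

lemma re_inner_pgm_add (E : Set X) (u k : H) (hk : 𝓔.averageState k = 0) :
    (⟪CFC.sqrt 𝓔.averageState u + k, 𝓔.pgm E (CFC.sqrt 𝓔.averageState u + k)⟫_ℂ).re =
      (⟪u, 𝓔.partialState E u⟫_ℂ).re + 𝓔.prior.real E * ‖k‖ ^ 2 := by
  have h1 : 𝓔.factor E (CFC.sqrt 𝓔.averageState u + k) = CFC.sqrt (𝓔.partialState E) u := by
    rw [map_add, ← (𝓔.factor_spec E).comp_sqrt]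
    have : 𝓔.factor E k = 0 := (𝓔.factor_spec E).ker_le hk
    rw [this, add_zero]; rfl
  have h2 : 𝓔.averageState.ker.starProjection (CFC.sqrt 𝓔.averageState u + k) = k := by
    have h3 : CFC.sqrt 𝓔.averageState u ∈ 𝓔.averageState.kerᗮ := by
      rw [← orthogonal_range_sqrt]
      exact Submodule.le_orthogonal_orthogonal _ ⟨u, rfl⟩
    rw [map_add, (Submodule.starProjection_apply_eq_zero_iff _).2 h3, zero_add]
    exact Submodule.starProjection_eq_self_iff.2 hk
  rw [re_inner_pgm, h1, h2, norm_sqrt_sq (𝓔.partialState_isPositive E)]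

lemma hasSum_re_inner_pgm_add {E : ℕ → Set X} (hE : ∀ n, MeasurableSet (E n))
    (hd : Pairwise (Function.onFun Disjoint E)) (u k : H) (hk : 𝓔.averageState k = 0) :
    HasSum (fun n =>
      (⟪CFC.sqrt 𝓔.averageState u + k, 𝓔.pgm (E n) (CFC.sqrt 𝓔.averageState u + k)⟫_ℂ).re)
      (⟪CFC.sqrt 𝓔.averageState u + k,
        𝓔.pgm (⋃ n, E n) (CFC.sqrt 𝓔.averageState u + k)⟫_ℂ).re := by
  simp_rw [𝓔.re_inner_pgm_add _ u k hk, inner_partialState, Complex.ofReal_re]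
  refine HasSum.add ?_ (HasSum.mul_right _ ?_)
  · exact hasSum_integral_iUnion hE hd (𝓔.integrable_quadForm u).integrableOn
  · have h1 : ∑' n, 𝓔.prior (E n) ≠ ⊤ := by
      rw [← measure_iUnion hd hE]; exact measure_ne_top _ _
    have h2 := ENNReal.hasSum_toReal h1
    rw [← ENNReal.tsum_toReal_eq (fun n => measure_ne_top _ _), ← measure_iUnion hd hE] at h2
    exact h2

lemma norm_sq_sqrt_add (u k : H) (hk : 𝓔.averageState k = 0) :
    ‖CFC.sqrt 𝓔.averageState u + k‖ ^ 2 = (⟪u, 𝓔.averageState u⟫_ℂ).re + ‖k‖ ^ 2 := by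
  have h1 : CFC.sqrt 𝓔.averageState k = 0 := by
    have : k ∈ (CFC.sqrt 𝓔.averageState).ker := by rw [ker_sqrt_averageState]; exact hk
    exact this
  rw [@norm_add_sq ℂ, inner_sqrt_apply, h1, inner_zero_right,
    norm_sqrt_sq 𝓔.averageState_isPositive]
  simp

lemma re_inner_pgm_univ (v : H) : (⟪v, 𝓔.pgm Set.univ v⟫_ℂ).re = ‖v‖ ^ 2 := by
  have hc : IsClosed {v : H | (⟪v, 𝓔.pgm Set.univ v⟫_ℂ).re = ‖v‖ ^ 2} :=
    isClosed_eq (by fun_prop) (by fun_prop)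
  have h : closure {v : H | ∃ u k, 𝓔.averageState k = 0 ∧ v = CFC.sqrt 𝓔.averageState u + k} ⊆
      {v : H | (⟪v, 𝓔.pgm Set.univ v⟫_ℂ).re = ‖v‖ ^ 2} := by
    refine closure_minimal ?_ hc
    rintro _ ⟨u, k, hk, rfl⟩
    rw [Set.mem_ofPred_eq, 𝓔.re_inner_pgm_add _ u k hk, 𝓔.norm_sq_sqrt_add u k hk,
      averageState_eq, probReal_univ, one_mul]
  exact h (𝓔.dense_range_add_ker v)

lemma pgm_univ : 𝓔.pgm Set.univ = 1 := by
  have h : ∀ v, ⟪(𝓔.pgm Set.univ).toLinearMap v, v⟫_ℂ = ⟪(LinearMap.id : H →ₗ[ℂ] H) v, v⟫_ℂ := by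
    intro v
    have h1 := (𝓔.pgm_isPositive Set.univ).inner_nonneg_right v
    have h2 := 𝓔.re_inner_pgm_univ v
    have h3 : ⟪v, 𝓔.pgm Set.univ v⟫_ℂ = ((‖v‖ ^ 2 : ℝ) : ℂ) := by
      rw [← h2]; exact Complex.eq_re_of_ofReal_le h1
    have h4 : ⟪𝓔.pgm Set.univ v, v⟫_ℂ = ((‖v‖ ^ 2 : ℝ) : ℂ) := by
      rw [← inner_conj_symm, h3, Complex.conj_ofReal]
    change ⟪𝓔.pgm Set.univ v, v⟫_ℂ = ⟪v, v⟫_ℂ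
    rw [h4, inner_self_eq_norm_sq_to_K]
    norm_cast
  have h5 := (ext_inner_map _ _).1 h
  ext v
  exact DFunLike.congr_fun h5 v

lemma re_inner_pgm_le (E : Set X) (v : H) : (⟪v, 𝓔.pgm E v⟫_ℂ).re ≤ ‖v‖ ^ 2 := by
  have hc : IsClosed {v : H | (⟪v, 𝓔.pgm E v⟫_ℂ).re ≤ ‖v‖ ^ 2} :=
    isClosed_le (by fun_prop) (by fun_prop)
  have h : closure {v : H | ∃ u k, 𝓔.averageState k = 0 ∧ v = CFC.sqrt 𝓔.averageState u + k} ⊆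
      {v : H | (⟪v, 𝓔.pgm E v⟫_ℂ).re ≤ ‖v‖ ^ 2} := by
    refine closure_minimal ?_ hc
    rintro _ ⟨u, k, hk, rfl⟩
    simp only [Set.mem_ofPred_eq, 𝓔.re_inner_pgm_add _ u k hk, 𝓔.norm_sq_sqrt_add u k hk]
    have h1 := 𝓔.norm_sqrt_partialState_le E u
    have h2 := pow_le_pow_left₀ (norm_nonneg _) h1 2
    rw [norm_sqrt_sq (𝓔.partialState_isPositive E),
      norm_sqrt_sq 𝓔.averageState_isPositive] at h2
    have h3 : 𝓔.prior.real E * ‖k‖ ^ 2 ≤ 1 * ‖k‖ ^ 2 := by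
      gcongr
      exact measureReal_le_one
    linarith
  exact h (𝓔.dense_range_add_ker v)

lemma hasSum_pgm {E : ℕ → Set X} (hE : ∀ n, MeasurableSet (E n))
    (hd : Pairwise (Function.onFun Disjoint E)) (ψ : H) :
    HasSum (fun n => 𝓔.pgm (E n) ψ) (𝓔.pgm (⋃ n, E n) ψ) := by
  let D : Finset ℕ → H →L[ℂ] H := fun s => 𝓔.pgm (⋃ n, E n) - ∑ n ∈ s, 𝓔.pgm (E n)
  have hDre : ∀ s v, (⟪v, D s v⟫_ℂ).re =
      (⟪v, 𝓔.pgm (⋃ n, E n) v⟫_ℂ).re - ∑ n ∈ s, (⟪v, 𝓔.pgm (E n) v⟫_ℂ).re := fun s v => by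
    simp only [D, sub_apply, sum_apply, inner_sub_right, inner_sum, Complex.sub_re,
      Complex.re_sum]
  have hDnn : ∀ s v, 0 ≤ (⟪v, D s v⟫_ℂ).re := fun s v => by
    have hc : IsClosed {v : H | 0 ≤ (⟪v, D s v⟫_ℂ).re} :=
      isClosed_le (by fun_prop) (by fun_prop)
    have h : closure {v : H | ∃ u k, 𝓔.averageState k = 0 ∧
        v = CFC.sqrt 𝓔.averageState u + k} ⊆ {v : H | 0 ≤ (⟪v, D s v⟫_ℂ).re} := by
      refine closure_minimal ?_ hc
      rintro _ ⟨u, k, hk, rfl⟩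
      rw [Set.mem_ofPred_eq, hDre, sub_nonneg]
      exact sum_le_hasSum s (fun n _ => (𝓔.pgm_isPositive (E n)).re_inner_nonneg_right _)
        (𝓔.hasSum_re_inner_pgm_add hE hd u k hk)
    exact h (𝓔.dense_range_add_ker v)
  have hDle : ∀ s v, (⟪v, D s v⟫_ℂ).re ≤ ‖v‖ ^ 2 := fun s v => by
    rw [hDre]
    have h1 : 0 ≤ ∑ n ∈ s, (⟪v, 𝓔.pgm (E n) v⟫_ℂ).re :=
      Finset.sum_nonneg fun n _ => (𝓔.pgm_isPositive (E n)).re_inner_nonneg_right v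
    linarith [𝓔.re_inner_pgm_le (⋃ n, E n) v]
  have hDpos : ∀ s, (D s).IsPositive := fun s => by
    have hsa : IsSelfAdjoint (D s) := (𝓔.pgm_isPositive _).isSelfAdjoint.sub
      (isSelfAdjoint_sum s fun n _ => (𝓔.pgm_isPositive (E n)).isSelfAdjoint)
    refine ContinuousLinearMap.isPositive_def'.2 ⟨hsa, fun v => ?_⟩
    rw [ContinuousLinearMap.reApplyInnerSelf_apply, inner_re_symm]
    exact hDnn s v
  have hDsq : ∀ s v, ‖D s v‖ ^ 2 ≤ (⟪v, D s v⟫_ℂ).re := fun s v => by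
    have h1 : ∀ w, ‖CFC.sqrt (D s) w‖ ≤ ‖w‖ := fun w => by
      refine (sq_le_sq₀ (norm_nonneg _) (norm_nonneg _)).1 ?_
      rw [norm_sqrt_sq (hDpos s)]
      exact hDle s w
    rw [← norm_sqrt_sq (hDpos s)]
    conv_lhs => rw [← sqrt_sqrt_apply (hDpos s)]
    gcongr
    exact h1 _
  have hDnorm : ∀ s v, ‖D s v‖ ≤ ‖v‖ := fun s v =>
    (sq_le_sq₀ (norm_nonneg _) (norm_nonneg _)).1 ((hDsq s v).trans (hDle s v))
  have key : Tendsto (fun s => D s ψ) atTop (𝓝 0) := by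
    rw [Metric.tendsto_nhds]
    intro ε hε
    obtain ⟨_, ⟨u, k, hk, rfl⟩, hv⟩ := 𝓔.dense_range_add_ker.exists_dist_lt ψ (half_pos hε)
    set v := CFC.sqrt 𝓔.averageState u + k
    have h1 : Tendsto (fun s => (⟪v, D s v⟫_ℂ).re) atTop (𝓝 0) := by
      have h2 := (tendsto_const_nhds (x := (⟪v, 𝓔.pgm (⋃ n, E n) v⟫_ℂ).re)).sub
        (𝓔.hasSum_re_inner_pgm_add hE hd u k hk)
      rw [sub_self] at h2
      exact h2.congr fun s => (hDre s v).symm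
    filter_upwards [h1.eventually (gt_mem_nhds (show (0 : ℝ) < (ε / 2) ^ 2 by positivity))] with s hs
    have h3 : ‖D s v‖ < ε / 2 :=
      (sq_lt_sq₀ (norm_nonneg _) (half_pos hε).le).1 ((hDsq s v).trans_lt hs)
    have h4 : ‖D s (ψ - v)‖ < ε / 2 := (hDnorm s _).trans_lt (by rwa [← dist_eq_norm])
    rw [dist_zero_right]
    calc ‖D s ψ‖ = ‖D s (ψ - v) + D s v‖ := by rw [← map_add, sub_add_cancel]
      _ ≤ ‖D s (ψ - v)‖ + ‖D s v‖ := norm_add_le _ _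
      _ < ε := by linarith
  have h5 := (tendsto_const_nhds (x := 𝓔.pgm (⋃ n, E n) ψ)).sub key
  rw [sub_zero] at h5
  refine h5.congr fun s => ?_
  simp [D]

/-- The generalized pretty good measurement of the ensemble, as a POVM. -/
def gpgm : POVM X H where
  toFun := 𝓔.pgm
  isPositive E _ := 𝓔.pgm_isPositive E
  univ := 𝓔.pgm_univ
  hasSum_iUnion _ hE hd ψ := 𝓔.hasSum_pgm hE hd ψ

end QuantumEnsemble
end Ensemble

section MSE

variable {N : ℕ} {H : Type*} [NormedAddCommGroup H] [InnerProductSpace ℂ H] [CompleteSpace H]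

namespace QuantumEnsemble

variable (𝓔 : QuantumEnsemble (EuclideanSpace ℝ (Fin N)) H)

/-- The mean square error of `m` at the true parameter `x`:
`∫ ‖x - y‖² Tr[ρ_x m(dy)]`, with values in `[0, ∞]`. -/
def mseAt (m : POVM (EuclideanSpace ℝ (Fin N)) H) (x : EuclideanSpace ℝ (Fin N)) : ℝ≥0∞ :=
  ∫⁻ y, ‖x - y‖ₑ ^ 2 ∂(outcomeMeasure (𝓔.state x) (𝓔.isDensityOperator x) m)

/-- The expected mean square error of `m`: `∫ ∫ ‖x - y‖² Tr[ρ_x m(dy)] μ(dx)`, in `[0, ∞]`. -/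
def mse (m : POVM (EuclideanSpace ℝ (Fin N)) H) : ℝ≥0∞ := ∫⁻ x, 𝓔.mseAt m x ∂𝓔.prior

end QuantumEnsemble

/-- The second moment `∫ ‖x‖² μ(dx)` of a measure on `ℝ^N`, in `[0, ∞]`. -/
def secondMoment (μ : Measure (EuclideanSpace ℝ (Fin N))) : ℝ≥0∞ := ∫⁻ x, ‖x‖ₑ ^ 2 ∂μ

end MSE
end QuantumEstimation

end

/-! Averaged over the prior, the outcome of the pretty good measurement has law `μ` again. Indeed,
linearity and cyclicity of the trace give `∫ Tr[ρ_x m(E)] μ(dx) = Tr[ρ m(E)] = Tr[ρ^(1/2) m(E)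
ρ^(1/2)]`. Since `Λ_E ρ^(1/2) = ρ_E^(1/2)` and the projection onto `ker ρ` kills the range of
`ρ^(1/2)`, the last operator is `ρ_E`, whose trace is `μ(E)`. This is `bind_outcomeMeasure_gpgm`.

The true parameter `x` and the estimate `y` thus form a random pair, both of whose marginals are
`μ`. Whatever their joint law, `‖x - y‖² ≤ 2‖x‖² + 2‖y‖²` bounds the mean square error by `2 + 2 =
4` times the second moment of `μ`.

All traces are written as sums of nonnegative diagonal terms in `[0, ∞]`. Cyclicity and the exchange
of trace and integral then reduce to reordering nonnegative sums and to Tonelli. The exchange with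
the integral uses that separability makes the basis countable. -/

namespace QuantumEstimation

/-! ### Cyclicity of the trace for positive operators, in `[0, ∞]`. -/

section HilbertSchmidt

variable {H : Type*} [NormedAddCommGroup H] [InnerProductSpace ℂ H] [CompleteSpace H]

/-- An operator and its adjoint have the same Hilbert-Schmidt norm, in `[0, ∞]`. -/
lemma tsum_norm_adjoint_sq {ι : Type*} (b : HilbertBasis ι ℂ H) (C : H →L[ℂ] H) :
    ∑' i, ENNReal.ofReal (‖C.adjoint (b i)‖ ^ 2) = ∑' i, ENNReal.ofReal (‖C (b i)‖ ^ 2) := by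
  have parseval : ∀ v : H, ENNReal.ofReal (‖v‖ ^ 2) =
      ∑' j, ENNReal.ofReal (‖⟪b j, v⟫_ℂ‖ ^ 2) := fun v => by
    have h := hasSum_norm_inner_sq b v
    rw [← h.tsum_eq]
    exact ENNReal.ofReal_tsum_of_nonneg (fun _ => sq_nonneg _) h.summable
  -- Both sides become double sums of squared matrix entries, of `C` and of its conjugate transpose;
  -- exchanging the order of summation identifies them.
  simp_rw [parseval (C _), parseval (C.adjoint _)]
  rw [ENNReal.tsum_comm]
  simp_rw [ContinuousLinearMap.adjoint_inner_right, norm_inner_symm]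

/-- Cyclicity of the trace: `Tr[T^(1/2) A T^(1/2)] = Tr[A^(1/2) T A^(1/2)]`. -/
lemma tsum_inner_sqrt_comm {ι : Type*} (b : HilbertBasis ι ℂ H) {T A : H →L[ℂ] H}
    (hT : T.IsPositive) (hA : A.IsPositive) :
    ∑' i, ENNReal.ofReal (⟪CFC.sqrt T (b i), A (CFC.sqrt T (b i))⟫_ℂ).re =
      ∑' i, ENNReal.ofReal (⟪CFC.sqrt A (b i), T (CFC.sqrt A (b i))⟫_ℂ).re := by
  -- With `C = T^(1/2) A^(1/2)`, the adjoint is `A^(1/2) T^(1/2)`, and the squared norms of the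
  -- columns of both are the two families of diagonal entries.
  have h := tsum_norm_adjoint_sq b (CFC.sqrt T ∘L CFC.sqrt A)
  rw [ContinuousLinearMap.adjoint_comp, (CFC.sqrt_nonneg T).isSelfAdjoint.adjoint_eq,
    (CFC.sqrt_nonneg A).isSelfAdjoint.adjoint_eq] at h
  simpa only [ContinuousLinearMap.comp_apply, norm_sqrt_sq hT, norm_sqrt_sq hA] using h

/-- Cyclicity moves the square root from the state to the measurement. The vectors then no longer
depend on `T`, which enters linearly; for `T = ρ_x` each term can therefore be measured and
integrated in `x` without studying `x ↦ ρ_x^(1/2)`. -/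
lemma outcomeMeasure_apply {X : Type*} [MeasurableSpace X] {T : H →L[ℂ] H}
    (hT : IsDensityOperator T) (m : POVM X H) {E : Set X} (hE : MeasurableSet E) :
    outcomeMeasure T hT m E = ∑' i, ENNReal.ofReal
      (⟪CFC.sqrt (m.toFun E) (stdBasis H i), T (CFC.sqrt (m.toFun E) (stdBasis H i))⟫_ℂ).re := by
  rw [outcomeMeasure, Measure.ofMeasurable_apply E hE, ofReal_opTrace hT (m.isPositive E hE),
    tsum_inner_sqrt_comm _ hT.isPositive (m.isPositive E hE)]

end HilbertSchmidt

/-! ### The outcome law averaged over the prior. -/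

namespace QuantumEnsemble

variable {X : Type*} [MeasurableSpace X] {H : Type*} [NormedAddCommGroup H]
  [InnerProductSpace ℂ H] [CompleteSpace H] [TopologicalSpace.SeparableSpace H]
  (𝓔 : QuantumEnsemble X H)

lemma measurable_ofReal_inner_state (v : H) :
    Measurable fun x => ENNReal.ofReal (⟪v, 𝓔.state x v⟫_ℂ).re := by
  borelize H
  have h : Measurable fun x => 𝓔.state x v := 𝓔.measurable.apply_continuousLinearMap v
  have hc : Continuous fun w : H => ENNReal.ofReal (⟪v, w⟫_ℂ).re :=
    ENNReal.continuous_ofReal.comp (by fun_prop)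
  exact hc.measurable.comp h

/-- The bridge from the Bochner integral defining `ρ_E` to integrals in `[0, ∞]`, where sums and
integrals can be exchanged freely. -/
lemma setLIntegral_ofReal_inner_state (E : Set X) (v : H) :
    ∫⁻ x in E, ENNReal.ofReal (⟪v, 𝓔.state x v⟫_ℂ).re ∂𝓔.prior =
      ENNReal.ofReal (⟪v, 𝓔.partialState E v⟫_ℂ).re := by
  rw [inner_partialState, Complex.ofReal_re]
  exact (ofReal_integral_eq_lintegral_ofReal (𝓔.integrable_quadForm v).integrableOn
    (Eventually.of_forall fun x =>
      (𝓔.isDensityOperator x).isPositive.re_inner_nonneg_right v)).symm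

/-- `Tr ρ_E = μ(E)`. -/
lemma tsum_inner_partialState (E : Set X) :
    ∑' i, ENNReal.ofReal (⟪stdBasis H i, 𝓔.partialState E (stdBasis H i)⟫_ℂ).re =
      𝓔.prior E := by
  -- Countability of the basis is what `lintegral_tsum` needs to exchange trace and integral.
  have := countable_of_hilbertBasis (stdBasis H)
  simp_rw [← setLIntegral_ofReal_inner_state]
  rw [← lintegral_tsum fun i => (𝓔.measurable_ofReal_inner_state _).aemeasurable]
  have h : ∀ x, ∑' i, ENNReal.ofReal (⟪stdBasis H i, 𝓔.state x (stdBasis H i)⟫_ℂ).re = 1 :=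
    fun x => by
      have hs := Complex.hasSum_re (𝓔.isDensityOperator x).trace_one
      refine (ENNReal.ofReal_tsum_of_nonneg (fun i =>
        (𝓔.isDensityOperator x).isPositive.re_inner_nonneg_right _) hs.summable).symm.trans ?_
      simp [hs.tsum_eq]
  simp [h]

/-- The outcome laws form a kernel in `x`, so that `Measure.bind` with the prior is the genuine
mixture. -/
lemma measurable_outcomeMeasure (m : POVM X H) :
    Measurable fun x => outcomeMeasure (𝓔.state x) (𝓔.isDensityOperator x) m := by
  have := countable_of_hilbertBasis (stdBasis H)
  refine Measure.measurable_of_measurable_coe _ fun E hE => ?_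
  simp_rw [outcomeMeasure_apply _ m hE]
  exact Measurable.tsum fun i => 𝓔.measurable_ofReal_inner_state _

/-- The unconditional law of the outcome of the generalized pretty good measurement is the
prior. -/
lemma bind_outcomeMeasure_gpgm :
    𝓔.prior.bind (fun x => outcomeMeasure (𝓔.state x) (𝓔.isDensityOperator x) 𝓔.gpgm) =
      𝓔.prior := by
  have := countable_of_hilbertBasis (stdBasis H)
  ext E hE
  rw [Measure.bind_apply hE (𝓔.measurable_outcomeMeasure _).aemeasurable]
  simp_rw [outcomeMeasure_apply _ 𝓔.gpgm hE]
  rw [lintegral_tsum fun i => (𝓔.measurable_ofReal_inner_state _).aemeasurable]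
  have hu : ∀ v, ∫⁻ x, ENNReal.ofReal (⟪v, 𝓔.state x v⟫_ℂ).re ∂𝓔.prior =
      ENNReal.ofReal (⟪v, 𝓔.averageState v⟫_ℂ).re := fun v => by
    rw [← setLIntegral_univ, setLIntegral_ofReal_inner_state, averageState_eq]
  simp_rw [hu]
  -- After integration only `ρ` is left, between two factors `m(E)^(1/2)`. Cyclicity turns this into
  -- `Tr[ρ^(1/2) m(E) ρ^(1/2)]`, and `μ(E)` is rewritten as `Tr ρ_E`, to be compared entry by entry.
  rw [← tsum_inner_sqrt_comm _ 𝓔.averageState_isPositive (𝓔.gpgm.isPositive E hE),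
    ← 𝓔.tsum_inner_partialState E]
  refine tsum_congr fun i => ?_
  -- Taking the kernel component to be `0` leaves only vectors in the range of `ρ^(1/2)`, so the
  -- term `μ(E) Π` drops out.
  have h := 𝓔.re_inner_pgm_add E (stdBasis H i) 0 (map_zero _)
  simp only [add_zero, norm_zero, ne_eq, OfNat.ofNat_ne_zero, not_false_eq_true, zero_pow,
    mul_zero] at h
  exact congrArg ENNReal.ofReal h

end QuantumEnsemble

/-! ### The mean square error bound. -/

lemma enorm_sub_sq_le {V : Type*} [SeminormedAddCommGroup V] (x y : V) :
    ‖x - y‖ₑ ^ 2 ≤ 2 * (‖x‖ₑ ^ 2 + ‖y‖ₑ ^ 2) := by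
  have h : ‖x - y‖₊ ^ 2 ≤ 2 * (‖x‖₊ ^ 2 + ‖y‖₊ ^ 2) :=
    (pow_le_pow_left₀ zero_le (nnnorm_sub_le x y) 2).trans add_sq_le
  simp only [enorm_eq_nnnorm]
  exact_mod_cast h

end QuantumEstimation

-- The bound is an inequality in `[0, ∞]` and holds without any moment assumption; a finite second
-- moment matters only for concluding that the error is finite.
open QuantumEstimation in
lemma QuantumEstimation.QuantumEnsemble.mse_gpgm_le {N : ℕ} {H : Type*} [NormedAddCommGroup H]
    [InnerProductSpace ℂ H] [CompleteSpace H] [TopologicalSpace.SeparableSpace H]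
    (𝓔 : QuantumEnsemble (EuclideanSpace ℝ (Fin N)) H) :
    𝓔.mse 𝓔.gpgm ≤ 4 * secondMoment 𝓔.prior := by
  have hκ := 𝓔.measurable_outcomeMeasure 𝓔.gpgm
  set κ := fun x => outcomeMeasure (𝓔.state x) (𝓔.isDensityOperator x) 𝓔.gpgm
  have hmeas : Measurable fun y : EuclideanSpace ℝ (Fin N) => ‖y‖ₑ ^ 2 := by fun_prop
  -- Each outcome law has total mass `Tr ρ_x = 1`, so the term `‖x‖²`, constant in `y`, integrates
  -- to itself.
  have hone : ∀ x, κ x Set.univ = 1 := fun x => by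
    have hs := (𝓔.isDensityOperator x).trace_one
    simp only [κ, outcomeMeasure, Measure.ofMeasurable_apply _ MeasurableSet.univ,
      𝓔.gpgm.univ, opTrace]
    simp [ContinuousLinearMap.one_def, hs.tsum_eq]
  calc 𝓔.mse 𝓔.gpgm
      ≤ ∫⁻ x, ∫⁻ y, 2 * (‖x‖ₑ ^ 2 + ‖y‖ₑ ^ 2) ∂κ x ∂𝓔.prior :=
        lintegral_mono fun x => lintegral_mono fun y => enorm_sub_sq_le x y
    _ = ∫⁻ x, 2 * (‖x‖ₑ ^ 2 + ∫⁻ y, ‖y‖ₑ ^ 2 ∂κ x) ∂𝓔.prior := by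
        refine lintegral_congr fun x => ?_
        rw [lintegral_const_mul _ (by fun_prop), lintegral_add_left (by fun_prop),
          lintegral_const, hone, mul_one]
    _ = 2 * (secondMoment 𝓔.prior + ∫⁻ x, ∫⁻ y, ‖y‖ₑ ^ 2 ∂κ x ∂𝓔.prior) := by
        rw [lintegral_const_mul' _ _ (by simp), lintegral_add_left hmeas, secondMoment]
    _ = 2 * (secondMoment 𝓔.prior + secondMoment 𝓔.prior) := by
        -- The iterated integral of `‖y‖²` is its integral against the averaged outcome law, which
        -- is the prior.
        rw [← Measure.lintegral_bind hκ.aemeasurable hmeas.aemeasurable,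
          𝓔.bind_outcomeMeasure_gpgm, secondMoment]
    _ = 4 * secondMoment 𝓔.prior := by ring

theorem mainTheorem8 {N : ℕ} {H : Type*} [NormedAddCommGroup H] [InnerProductSpace ℂ H]
    [CompleteSpace H] [TopologicalSpace.SeparableSpace H]
    (𝓔 : QuantumEstimation.QuantumEnsemble (EuclideanSpace ℝ (Fin N)) H)
    (hμ : QuantumEstimation.secondMoment 𝓔.prior < ∞) :
    𝓔.mse 𝓔.gpgm < ∞ ∧ 𝓔.mse 𝓔.gpgm ≤ 4 * QuantumEstimation.secondMoment 𝓔.prior :=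
  ⟨𝓔.mse_gpgm_le.trans_lt (ENNReal.mul_lt_top (by simp) hμ), 𝓔.mse_gpgm_le⟩
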